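/- Let $\mathbb{T}$ be the unit circle and $\mu$ the uniform probability measure on it. Let $A$ be a finite alphabet and let $\{F_a : a\in A\}$ be a Möbius iterative system, i.e. each $F_a$ is a Möbius transformation mapping the closed unit disc onto itself. For a word $v=v_0\cdots v_{n-1}$ put $F_v=F_{v_0}\circ\cdots\circ F_{v_{n-1}}$, and let $V_v=\{x\in\mathbb{T} : |(F_v^{-1})'(x)|>1\}$ be the expansion interval of $F_v^{-1}$. An infinite word $w\in A^{\omega}$ represents $x\in\mathbb{T}$, written $\Phi(w)=x$, if the image measures $F_{w_0\cdots w_{n-1}}\mu$ converge in the weak$^*$ topology to the Dirac measure $\delta_x$ as $n\to\infty$; $\mathbb{X}_F$ is the set of all words that represent some point. A subshift (closed shift-invariant set) $\Sigma\subset A^{\omega}$ is a Möbius number system for $\{F_a\}$ if $\Sigma\subset\mathbb{X}_F$, $\Phi(\Sigma)=\mathbb{T}$ and $\Phi|_{\Sigma}$ is continuous. Assume that there is a finite set $B$ of nonempty words over $A$ such that the closures $\{\overline{V}_b : b\in B\}$ cover $\mathbb{T}$. Then there exists a subshift $\Sigma\subset A^{\omega}$ that is a Möbius number system for $\{F_a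 : a\in A\}$. Moreover, this assumption is implied by the assumption that the sets $V_u$, with $u$ ranging over all nonempty words over $A$, cover $\mathbb{T}$. -/

import Mathlib

open MeasureTheory Filter Topology

namespace MobiusNumeration

open scoped Pointwise

/-- The unit circle carries its Borel σ-algebra. -/
noncomputable instance : MeasurableSpace Circle := borel Circle

instance : BorelSpace Circle := ⟨rfl⟩

/-- The closed unit disc, as a subset of the Riemann sphere `ℂ ∪ {∞}`. -/
def closedUnitDisc : Set (OnePoint ℂ) :=
  (fun z : ℂ => (z : OnePoint ℂ)) '' Metric.closedBall (0 : ℂ) 1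

/-- Disc preserving Möbius transformations, given by their matrices: the regular complex `2 × 2`
matrices whose Möbius action on the Riemann sphere maps the closed unit disc onto itself.
Composition of transformations is the product of this group. -/
abbrev DiscMobius : Type :=
  MulAction.stabilizer (Matrix.GeneralLinearGroup (Fin 2) ℂ) closedUnitDisc

/-- The expression `(a z + b) / (c z + d)` on the complex plane. -/
noncomputable def frac (g : Matrix.GeneralLinearGroup (Fin 2) ℂ) (z : ℂ) : ℂ :=
  (g 0 0 * z + g 0 1) / (g 1 0 * z + g 1 1)

/-- A disc preserving transformation has no pole on the closed unit disc. -/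
theorem denom_ne_zero (F : DiscMobius) {z : ℂ} (hz : ‖z‖ ≤ 1) :
    F.1 1 0 * z + F.1 1 1 ≠ 0 := by
  intro h
  have h1 : F.1 • (z : OnePoint ℂ) ∈ F.1 • closedUnitDisc :=
    Set.smul_mem_smul_set ⟨z, by simpa using hz, rfl⟩
  rw [MulAction.mem_stabilizer_iff.1 F.2, OnePoint.smul_some_eq_ite, if_pos h] at h1
  obtain ⟨w, -, hw⟩ := h1
  exact OnePoint.coe_ne_infty w hw

theorem norm_frac_le (F : DiscMobius) {z : ℂ} (hz : ‖z‖ ≤ 1) : ‖frac F.1 z‖ ≤ 1 := by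
  have h1 : F.1 • (z : OnePoint ℂ) ∈ F.1 • closedUnitDisc :=
    Set.smul_mem_smul_set ⟨z, by simpa using hz, rfl⟩
  rw [MulAction.mem_stabilizer_iff.1 F.2, OnePoint.smul_some_eq_ite,
    if_neg (denom_ne_zero F hz)] at h1
  obtain ⟨w, hw, hw'⟩ := h1
  have : w = frac F.1 z := OnePoint.coe_injective hw'
  simpa [this] using hw

theorem one_lt_norm_frac (F : DiscMobius) {z : ℂ} (hz : 1 < ‖z‖)
    (hd : F.1 1 0 * z + F.1 1 1 ≠ 0) : 1 < ‖frac F.1 z‖ := by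
  by_contra! h
  have h1 : F.1 • (z : OnePoint ℂ) ∈ F.1 • closedUnitDisc := by
    rw [MulAction.mem_stabilizer_iff.1 F.2, OnePoint.smul_some_eq_ite, if_neg hd]
    exact ⟨frac F.1 z, by simpa using h, rfl⟩
  rw [Set.smul_mem_smul_set_iff] at h1
  obtain ⟨w, hw, hw'⟩ := h1
  have : w = z := OnePoint.coe_injective hw'
  rw [this] at hw
  simp only [Metric.mem_closedBall, dist_zero_right] at hw
  linarith

/-- A disc preserving transformation maps the unit circle to itself. -/
theorem norm_frac_eq_one (F : DiscMobius) (z : Circle) : ‖frac F.1 z‖ = 1 := by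
  have hz : ‖(z : ℂ)‖ = 1 := z.norm_coe
  refine le_antisymm (norm_frac_le F hz.le) ?_
  have hd := denom_ne_zero F hz.le
  have hden : ContinuousAt (fun t : ℝ => F.1 1 0 * (t * (z : ℂ)) + F.1 1 1) 1 := by fun_prop
  have hc : ContinuousAt (fun t : ℝ => ‖frac F.1 (t * (z : ℂ))‖) 1 := by
    unfold frac
    refine (ContinuousAt.div (by fun_prop) hden ?_).norm
    simpa using hd
  have ht : Tendsto (fun t : ℝ => ‖frac F.1 (t * (z : ℂ))‖) (𝓝[>] 1) (𝓝 ‖frac F.1 z‖) := by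
    have := hc.tendsto.mono_left (nhdsWithin_le_nhds (s := Set.Ioi (1 : ℝ)))
    simpa using this
  refine ge_of_tendsto ht ?_
  have hne : ∀ᶠ t : ℝ in 𝓝[>] 1, F.1 1 0 * (t * (z : ℂ)) + F.1 1 1 ≠ 0 :=
    (hden.eventually_ne (by simpa using hd)).filter_mono nhdsWithin_le_nhds
  filter_upwards [hne, self_mem_nhdsWithin] with t h1 h2
  refine (one_lt_norm_frac F ?_ h1).le
  have h2' : (1 : ℝ) < t := h2
  rw [norm_mul, hz, mul_one, Complex.norm_real, Real.norm_eq_abs]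
  exact lt_of_lt_of_le h2' (le_abs_self t)

/-- The action of a disc preserving Möbius transformation on the unit circle. -/
noncomputable def circleMap (F : DiscMobius) (z : Circle) : Circle :=
  ⟨frac F.1 z, mem_sphere_zero_iff_norm.2 (norm_frac_eq_one F z)⟩

/-- The modulus of the complex derivative of `F` at the point `x` of the unit circle. -/
noncomputable def derivModulus (F : DiscMobius) (x : Circle) : ℝ :=
  ‖deriv (frac F.1) (x : ℂ)‖

/-- The expansion interval `V` of `F⁻¹`: the set of points of the unit circle at which the
modulus of the derivative of `F⁻¹` is greater than `1`. -/
def expansionInterval (F : DiscMobius) : Set Circle :=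
  {x | 1 < derivModulus F⁻¹ x}

/-- The uniform probability measure on the unit circle: the image of normalized arc length. -/
noncomputable def uniformMeasure : Measure Circle :=
  ENNReal.ofReal (2 * Real.pi)⁻¹ • (volume.restrict (Set.Ioc 0 (2 * Real.pi))).map Circle.exp

/-- The sequence `F` represents the point `x` of the circle: the images of the uniform
probability measure under `F n` converge to the Dirac measure at `x` in the weak* topology. -/
def Represents (F : ℕ → DiscMobius) (x : Circle) : Prop :=
  ∀ f : C(Circle, ℝ),
    Tendsto (fun n => ∫ z, f z ∂(uniformMeasure.map (circleMap (F n)))) atTop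
      (𝓝 (∫ z, f z ∂(Measure.dirac x)))

section Systems

variable {A : Type*}

/-- The transformation `F_v = F_{v₀} ∘ F_{v₁} ∘ ⋯` assigned to a finite word `v`. -/
noncomputable def wordMap (F : A → DiscMobius) (v : List A) : DiscMobius :=
  (v.map F).prod

/-- The prefix of length `n` of an infinite word. -/
def wordPrefix (w : ℕ → A) (n : ℕ) : List A :=
  (List.range n).map w

/-- The set of the infinite words that represent some point of the circle: the domain of `Φ`. -/
def representingWords (F : A → DiscMobius) : Set (ℕ → A) :=
  {w | ∃ x : Circle, Represents (fun n => wordMap F (wordPrefix w n)) x}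

/-- The map `Φ`, which sends an infinite word to the point that it represents. -/
noncomputable def valueMap (F : A → DiscMobius) (w : representingWords F) : Circle :=
  w.2.choose

/-- A subshift `S` of one-sided infinite words is a Möbius number system for the iterative
system `F` if `Φ` is defined on all of `S`, maps `S` onto the circle and is continuous on `S`. -/
structure IsMobiusNumberSystem [TopologicalSpace A] (F : A → DiscMobius)
    (S : SymbolicDynamics.FullShift.Subshift A ℕ) : Prop where
  subset_domain : S.carrier ⊆ representingWords F
  image_eq_univ : valueMap F '' (Subtype.val ⁻¹' S.carrier) = Set.univ
  continuousOn : ContinuousOn (valueMap F) (Subtype.val ⁻¹' S.carrier)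

end Systems

end MobiusNumeration

namespace MobiusNumeration

open scoped ComplexConjugate

/-! Everything is read off from the image p = F(0) of the centre. For x on the circle, K = (x +
p)/(x - p) has real part |(F⁻¹)'(x)| and satisfies |x - p| ≤ 2/|K|. Since p → x suffices for
representation, it is enough that |K| → ∞ along the prefixes of a word. In half plane coordinates
that put F⁻¹x and x at infinity, F is the affine map w ↦ Dw + iN with D + iN = K (`cayley_frac`), so
kernels of products obey a cocycle rule (`kernel_mul`).

Let the closures of finitely many expansion intervals cover the circle. Each x has an itinerary of
blocks such that, for every n, x is a limit of points strictly expanded at all of the first n steps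
(`exists_forall_mem_closure_expandingSet`). Then D never decreases along the itinerary. If D is
unbounded, so is K. If D stays bounded, the steps become almost translations whose shifts are
bounded away from 0, and the only danger is that shifts of opposite sign cancel. The nearby points
expanded by two consecutive steps exclude this (`kernel_im_mul_pos`, made uniform by compactness),
so |N| → ∞ (`tendsto_norm_kernel`).

The pairs of an itinerary and its point form a compact set. Concatenating blocks and dropping
boundedly many initial letters turns it into a compact, shift invariant relation between words and
the points they represent; such a relation is the graph of a continuous map. The final claim of the
theorem holds because expansion intervals are open and the circle is compact. -/

theorem smul_coe_eq_frac (F : DiscMobius) {z : ℂ} (hz : ‖z‖ ≤ 1) :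
    F.1 • (z : OnePoint ℂ) = (frac F.1 z : OnePoint ℂ) := by
  rw [OnePoint.smul_some_eq_ite, if_neg (denom_ne_zero F hz)]
  rfl

theorem frac_mul (F G : DiscMobius) {z : ℂ} (hz : ‖z‖ ≤ 1) :
    frac (F * G).1 z = frac F.1 (frac G.1 z) := by
  have h := smul_coe_eq_frac (F * G) hz
  rw [Subgroup.coe_mul, mul_smul, smul_coe_eq_frac G hz,
    smul_coe_eq_frac F (norm_frac_le G hz)] at h
  exact (OnePoint.coe_injective h).symm

theorem frac_one (z : ℂ) : frac (1 : DiscMobius).1 z = z := by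
  simp [frac]

theorem frac_inv_frac (F : DiscMobius) {z : ℂ} (hz : ‖z‖ ≤ 1) :
    frac F⁻¹.1 (frac F.1 z) = z := by
  rw [← frac_mul _ _ hz, inv_mul_cancel, frac_one]

theorem circleMap_mul (F G : DiscMobius) (z : Circle) :
    circleMap (F * G) z = circleMap F (circleMap G z) :=
  Subtype.ext (frac_mul F G z.norm_coe.le)

theorem circleMap_one (z : Circle) : circleMap 1 z = z :=
  Subtype.ext (frac_one _)

theorem circleMap_circleMap_inv (F : DiscMobius) (z : Circle) :
    circleMap F (circleMap F⁻¹ z) = z := by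
  rw [← circleMap_mul, mul_inv_cancel, circleMap_one]

theorem coe_circleMap (F : DiscMobius) (z : Circle) : (circleMap F z : ℂ) = frac F.1 z := rfl

/-! ### Normal form of disc automorphisms -/

theorem det_ne_zero (F : DiscMobius) : F.1 0 0 * F.1 1 1 - F.1 0 1 * F.1 1 0 ≠ 0 := by
  have h := F.1.det_ne_zero
  rwa [Matrix.det_fin_two] at h

/-- Two trigonometric polynomials of degree one that agree on the unit circle have the same
coefficients. -/
theorem eq_of_normSq_eq_on_circle {a b c d : ℂ}
    (h : ∀ z : Circle, ‖a * z + b‖ = ‖c * z + d‖) :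
    Complex.normSq a + Complex.normSq b = Complex.normSq c + Complex.normSq d ∧
      a * conj b = c * conj d := by
  have key : ∀ z : Circle, Complex.normSq (a * z + b) = Complex.normSq (c * z + d) := by
    intro z
    rw [Complex.normSq_eq_norm_sq, Complex.normSq_eq_norm_sq, h z]
  -- Since |az + b|² = |a|² + |b|² + 2 Re(a b̄ z) on the circle, the values at 1, -1 and i determine
  -- the coefficients.
  have h1 := key 1
  have h2 := key (-1)
  have h3 := key ⟨Complex.I, by simp [Submonoid.unitSphere]⟩
  simp only [Circle.coe_one, Circle.coe_neg, Complex.normSq_apply, Complex.add_re, Complex.add_im,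
    Complex.mul_re, Complex.mul_im, Complex.I_re, Complex.I_im, Complex.neg_re, Complex.neg_im,
    Complex.one_re, Complex.one_im] at h1 h2 h3
  refine ⟨?_, Complex.ext ?_ ?_⟩ <;>
    simp only [Complex.normSq_apply, Complex.mul_re, Complex.mul_im, Complex.conj_re,
      Complex.conj_im] <;> linarith

/-- Disc preserving transformations in normal form. -/
theorem exists_frac_eq (F : DiscMobius) : ∃ s q : ℂ, ‖s‖ = 1 ∧ ‖q‖ < 1 ∧
    ∀ z, frac F.1 z = s * (z + q) / (1 + conj q * z) := by
  set a := F.1 0 0 with ha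
  set b := F.1 0 1 with hb
  set c := F.1 1 0 with hc
  set d := F.1 1 1 with hd
  have hden : ∀ z : ℂ, ‖z‖ ≤ 1 → c * z + d ≠ 0 := fun z hz => denom_ne_zero F hz
  have hdet : a * d - b * c ≠ 0 := det_ne_zero F
  have hd0 : d ≠ 0 := by simpa using hden 0 (by simp)
  -- Otherwise the pole -d/c would lie in the closed disc.
  have hcd : ‖c‖ < ‖d‖ := by
    by_contra! hle
    have hc0 : c ≠ 0 := by
      intro h0
      rw [h0, norm_zero] at hle
      exact hd0 (norm_le_zero_iff.1 hle)
    refine hden (-d / c) ?_ (by field_simp; ring)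
    rw [norm_div, norm_neg]
    exact div_le_one_of_le₀ hle (norm_nonneg _)
  obtain ⟨hsum, hprod⟩ := eq_of_normSq_eq_on_circle (a := a) (b := b) (c := c) (d := d) (by
    intro z
    have h := norm_frac_eq_one F z
    rw [frac, norm_div, div_eq_one_iff_eq (norm_ne_zero_iff.2 (denom_ne_zero F z.norm_coe.le))]
      at h
    exact h)
  have hp2 : Complex.normSq a * Complex.normSq b = Complex.normSq c * Complex.normSq d := by
    have := congrArg Complex.normSq hprod
    simpa using this
  have hcd2 : Complex.normSq c < Complex.normSq d := by
    rw [Complex.normSq_eq_norm_sq, Complex.normSq_eq_norm_sq]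
    gcongr
  -- The pairs |a|², |b|² and |c|², |d|² have the same sum and product, hence agree up to order; the
  -- order |a| = |c| forces a vanishing determinant.
  have hfac : (Complex.normSq a - Complex.normSq d) * (Complex.normSq a - Complex.normSq c) = 0 := by
    linear_combination Complex.normSq a * hsum - hp2
  have had : Complex.normSq a = Complex.normSq d := by
    rcases mul_eq_zero.1 hfac with h | h
    · linarith
    · exfalso
      have hac : Complex.normSq a = Complex.normSq c := by linarith
      have hbd : Complex.normSq b = Complex.normSq d := by linarith
      apply hdet
      have e1 : a * conj a = c * conj c := by
        rw [Complex.mul_conj, Complex.mul_conj, hac]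
      have hd' : conj d ≠ 0 := by simpa using hd0
      have e2 : b * conj b = d * conj d := by
        rw [Complex.mul_conj, Complex.mul_conj, hbd]
      have hb0 : conj b ≠ 0 := by
        intro h0
        rw [h0, mul_zero] at e2
        exact mul_ne_zero hd0 hd' e2.symm
      apply mul_right_cancel₀ hb0
      linear_combination d * hprod - c * e2
  have hbc : Complex.normSq b = Complex.normSq c := by linarith
  have hd' : conj d ≠ 0 := by simpa using hd0
  have e1 : a * conj a = d * conj d := by rw [Complex.mul_conj, Complex.mul_conj, had]
  have ha0 : a ≠ 0 := by
    intro h0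
    rw [h0, zero_mul] at e1
    exact mul_ne_zero hd0 hd' e1.symm
  have hprod' : conj a * b = conj c * d := by
    have := congrArg conj hprod
    simpa using this
  have hb' : b * conj d = a * conj c := by
    apply mul_right_cancel₀ hd0
    linear_combination a * hprod' - b * e1
  refine ⟨a / d, conj c / conj d, ?_, ?_, ?_⟩
  · rw [norm_div, div_eq_one_iff_eq (norm_ne_zero_iff.2 hd0)]
    rw [Complex.normSq_eq_norm_sq, Complex.normSq_eq_norm_sq] at had
    exact (sq_eq_sq₀ (norm_nonneg _) (norm_nonneg _)).1 had
  · rw [norm_div, RCLike.norm_conj, RCLike.norm_conj]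
    exact (div_lt_one (norm_pos_iff.2 hd0)).2 hcd
  · intro z
    have hbb : b = a * conj c / conj d := by
      field_simp
      linear_combination hb'
    have e3 : a / d * (z + conj c / conj d) = (a * z + b) / d := by
      rw [hbb]; field_simp
    have e4 : 1 + conj (conj c / conj d) * z = (c * z + d) / d := by
      rw [map_div₀, Complex.conj_conj, Complex.conj_conj]; field_simp; ring
    rw [e3, e4, div_div_div_cancel_right₀ hd0]
    rfl

/-! ### The Herglotz kernel and its cocycle rule -/

/-- The image of the centre of the disc. -/
noncomputable def center (F : DiscMobius) : ℂ := frac F.1 0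

theorem one_add_conj_mul_ne_zero {q z : ℂ} (hq : ‖q‖ < 1) (hz : ‖z‖ ≤ 1) :
    1 + conj q * z ≠ 0 := by
  intro h
  have h1 : ‖conj q * z‖ = 1 := by
    rw [← norm_one (α := ℂ), ← norm_neg (1 : ℂ)]
    congr 1
    linear_combination h
  rw [norm_mul, RCLike.norm_conj] at h1
  nlinarith [norm_nonneg q, norm_nonneg z]

theorem conj_coe_circle (x : Circle) : conj (x : ℂ) = (x : ℂ)⁻¹ := by
  rw [← Circle.coe_inv, Circle.coe_inv_eq_conj]

theorem norm_center_lt (F : DiscMobius) : ‖center F‖ < 1 := by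
  obtain ⟨s, q, hs, hq, h⟩ := exists_frac_eq F
  simpa [center, h, hs] using hq

theorem coe_ne_of_norm_lt {p : ℂ} (hp : ‖p‖ < 1) (x : Circle) : (x : ℂ) ≠ p := by
  rintro rfl
  exact absurd x.norm_coe hp.ne

theorem center_mul (F G : DiscMobius) : center (F * G) = frac F.1 (center G) :=
  frac_mul F G (by simp)

/-- The Herglotz kernel at `x`, evaluated at the image of the centre of the disc. -/
noncomputable def kernel (F : DiscMobius) (x : Circle) : ℂ :=
  ((x : ℂ) + center F) / ((x : ℂ) - center F)

theorem kernel_re_eq (F : DiscMobius) (x : Circle) :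
    (kernel F x).re = (1 - ‖center F‖ ^ 2) / ‖(x : ℂ) - center F‖ ^ 2 := by
  have hx : Complex.normSq (x : ℂ) = 1 := Circle.normSq_coe x
  rw [kernel, Complex.div_re, ← add_div, ← Complex.normSq_eq_norm_sq, ← Complex.normSq_eq_norm_sq]
  congr 1
  simp only [Complex.normSq_apply, Complex.add_re, Complex.sub_re, Complex.add_im,
    Complex.sub_im] at hx ⊢
  linear_combination hx

/-- The modulus of the derivative of the inverse transformation is a Poisson kernel. -/
theorem derivModulus_inv_eq (F : DiscMobius) (x : Circle) :
    derivModulus F⁻¹ x = (kernel F x).re := by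
  obtain ⟨s, q, hs, hq, h⟩ := exists_frac_eq F⁻¹
  have hs0 : s ≠ 0 := by
    rintro rfl
    simp at hs
  have hx := one_add_conj_mul_ne_zero hq x.norm_coe.le
  have hp : center F = -q := by
    have h1 : frac F⁻¹.1 (center F) = 0 := frac_inv_frac F (z := 0) (by simp)
    rw [h, div_eq_zero_iff, mul_eq_zero] at h1
    have := one_add_conj_mul_ne_zero hq (norm_center_lt F).le
    rcases h1 with (h1 | h1) | h1
    · exact absurd h1 hs0
    · linear_combination h1
    · exact absurd h1 this
  have hd : HasDerivAt (frac F⁻¹.1)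
      (s * (1 - q * conj q) / (1 + conj q * (x : ℂ)) ^ 2) (x : ℂ) := by
    have e : frac F⁻¹.1 = fun z => s * (z + q) / (1 + conj q * z) := funext h
    rw [e]
    have h1 : HasDerivAt (fun z : ℂ => s * (z + q)) s (x : ℂ) := by
      simpa using ((hasDerivAt_id (x : ℂ)).add_const q).const_mul s
    have h2 : HasDerivAt (fun z : ℂ => 1 + conj q * z) (conj q) (x : ℂ) := by
      simpa using ((hasDerivAt_id (x : ℂ)).const_mul (conj q)).const_add 1
    refine (h1.div h2 hx).congr_deriv ?_
    ring
  rw [derivModulus, hd.deriv, kernel_re_eq, hp, norm_div, norm_mul, hs, one_mul, norm_pow,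
    norm_neg, sub_neg_eq_add]
  congr 1
  · rw [Complex.mul_conj, Complex.normSq_eq_norm_sq, ← Complex.ofReal_one, ← Complex.ofReal_sub,
      Complex.norm_real, Real.norm_of_nonneg]
    nlinarith [norm_nonneg q]
  · congr 1
    have : (x : ℂ) + q = x * conj (1 + conj q * (x : ℂ)) := by
      rw [map_add, map_mul, map_one, Complex.conj_conj, conj_coe_circle]
      have := x.coe_ne_zero
      field_simp
    rw [this, norm_mul, RCLike.norm_conj, x.norm_coe, one_mul]

theorem mem_expansionInterval (F : DiscMobius) (x : Circle) :
    x ∈ expansionInterval F ↔ 1 < (kernel F x).re := by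
  rw [← derivModulus_inv_eq]; rfl

/-- In the half plane model a disc preserving transformation that maps `∞` to `∞` is affine. -/
theorem cayley_frac (F : DiscMobius) (x : Circle) {z : ℂ} (hz : ‖z‖ ≤ 1) (hzx : z ≠ x) :
    ((circleMap F x : ℂ) + frac F.1 z) / ((circleMap F x : ℂ) - frac F.1 z) =
      (kernel F (circleMap F x)).re * (((x : ℂ) + z) / ((x : ℂ) - z)) +
        (kernel F (circleMap F x)).im * Complex.I := by
  obtain ⟨s, q, hs, hq, h⟩ := exists_frac_eq F
  have hs0 : s ≠ 0 := by
    rintro rfl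
    simp at hs
  have hx0 : (x : ℂ) ≠ 0 := x.coe_ne_zero
  have hx := one_add_conj_mul_ne_zero hq x.norm_coe.le
  have hz1 := one_add_conj_mul_ne_zero hq hz
  have hx2 : 1 + (x : ℂ) * conj q ≠ 0 := by rwa [mul_comm (x : ℂ)]
  have hz2 : 1 + z * conj q ≠ 0 := by rwa [mul_comm z]
  have hzx' : (x : ℂ) - z ≠ 0 := sub_ne_zero.2 hzx.symm
  have hqq : Complex.normSq q < 1 := by
    rw [Complex.normSq_eq_norm_sq]
    nlinarith [norm_nonneg q]
  have hq1 : (1 : ℂ) - q * conj q ≠ 0 := by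
    rw [Complex.mul_conj, ← Complex.ofReal_one, ← Complex.ofReal_sub]
    exact Complex.ofReal_ne_zero.2 (by linarith)
  -- With x̄ = 1/x, the kernel and its conjugate are rational in x, q and q̄; their half sum and
  -- half difference give the two coefficients, and the claim becomes a field identity.
  have hK : kernel F (circleMap F x) = (1 + q * conj q + 2 * q / x) / (1 - q * conj q) := by
    have e1 : (circleMap F x : ℂ) - center F =
        s * x * (1 - q * conj q) / (1 + conj q * x) := by
      rw [coe_circleMap, center, h, h]
      field_simp
      ring
    have e2 : (circleMap F x : ℂ) + center F =
        s * (x + 2 * q + q * conj q * x) / (1 + conj q * x) := by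
      rw [coe_circleMap, center, h, h]
      field_simp
      ring
    rw [kernel, e1, e2]
    field_simp
    ring
  have hKc : conj (kernel F (circleMap F x)) =
      (1 + q * conj q + 2 * conj q * x) / (1 - q * conj q) := by
    rw [hK]
    simp only [map_div₀, map_add, map_mul, map_sub, map_one, Complex.conj_conj, conj_coe_circle,
      map_ofNat]
    field_simp
  have hre : ((kernel F (circleMap F x)).re : ℂ) =
      (1 + q * conj q + q / x + conj q * x) / (1 - q * conj q) := by
    rw [Complex.re_eq_add_conj, hKc, hK]
    field_simp
    ring
  have him : ((kernel F (circleMap F x)).im : ℂ) * Complex.I =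
      (q / x - conj q * x) / (1 - q * conj q) := by
    have h1 := Complex.re_add_im (kernel F (circleMap F x))
    have h2 : ((kernel F (circleMap F x)).im : ℂ) * Complex.I =
      kernel F (circleMap F x) - (kernel F (circleMap F x)).re := by linear_combination h1
    rw [h2, hre, hK]
    field_simp
    ring
  have e1 : (circleMap F x : ℂ) - frac F.1 z =
      s * (x - z) * (1 - q * conj q) / ((1 + conj q * x) * (1 + conj q * z)) := by
    rw [coe_circleMap, h, h]
    field_simp
    ring
  have e2 : (circleMap F x : ℂ) + frac F.1 z =
      s * ((x + q) * (1 + conj q * z) + (z + q) * (1 + conj q * x)) /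
        ((1 + conj q * x) * (1 + conj q * z)) := by
    rw [coe_circleMap, h, h]
    field_simp
  rw [e1, e2, hre, him]
  field_simp
  ring

/-- The centre of `F * G` is the image under `F` of the centre of `G`, and `F` is affine in the
coordinates with F⁻¹x and x at infinity. -/
theorem kernel_mul (F G : DiscMobius) (x : Circle) :
    kernel (F * G) x = (kernel F x).re * kernel G (circleMap F⁻¹ x) +
      (kernel F x).im * Complex.I := by
  have h := cayley_frac F (circleMap F⁻¹ x) (norm_center_lt G).le
    (coe_ne_of_norm_lt (norm_center_lt G) _).symm
  rw [circleMap_circleMap_inv] at h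
  rw [kernel, center_mul, h]
  rfl

theorem kernel_mul_re (F G : DiscMobius) (x : Circle) :
    (kernel (F * G) x).re = (kernel F x).re * (kernel G (circleMap F⁻¹ x)).re := by
  simp [kernel_mul]

theorem kernel_mul_im (F G : DiscMobius) (x : Circle) :
    (kernel (F * G) x).im =
      (kernel F x).re * (kernel G (circleMap F⁻¹ x)).im + (kernel F x).im := by
  simp [kernel_mul]

theorem continuous_kernel (F : DiscMobius) : Continuous (kernel F) := by
  unfold kernel
  exact (continuous_subtype_val.add continuous_const).div (continuous_subtype_val.sub continuous_const)
    fun x => sub_ne_zero.2 (coe_ne_of_norm_lt (norm_center_lt F) x)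

theorem isOpen_expansionInterval (F : DiscMobius) : IsOpen (expansionInterval F) := by
  simp only [expansionInterval, derivModulus_inv_eq]
  exact isOpen_lt continuous_const (Complex.continuous_re.comp (continuous_kernel F))

theorem one_le_kernel_re_of_mem_closure {F : DiscMobius} {x : Circle}
    (hx : x ∈ closure (expansionInterval F)) : 1 ≤ (kernel F x).re := by
  have hc : IsClosed {y | 1 ≤ (kernel F y).re} :=
    isClosed_le continuous_const (Complex.continuous_re.comp (continuous_kernel F))
  exact closure_minimal (fun y hy => ((mem_expansionInterval F y).1 hy).le) hc hx

theorem continuousOn_frac (F : DiscMobius) :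
    ContinuousOn (frac F.1) (Metric.closedBall 0 1) := by
  unfold frac
  exact ContinuousOn.div (by fun_prop) (by fun_prop) fun z hz => denom_ne_zero F (by simpa using hz)

theorem continuous_circleMap (F : DiscMobius) : Continuous (circleMap F) := by
  refine Continuous.subtype_mk ?_ _
  exact (continuousOn_frac F).comp_continuous continuous_subtype_val
    fun x => by simpa using x.norm_coe.le

/-- The diameter of the image of a disc of radius less than one is small if the image of the
centre is close to the boundary. -/
theorem norm_frac_sub_center_le (F : DiscMobius) {z : ℂ} (hz : ‖z‖ < 1) :
    ‖frac F.1 z - center F‖ ≤ (1 - ‖center F‖ ^ 2) / (1 - ‖z‖) := by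
  obtain ⟨s, q, hs, hq, h⟩ := exists_frac_eq F
  have hz1 := one_add_conj_mul_ne_zero hq hz.le
  have hz2 : 1 + z * conj q ≠ 0 := by rwa [mul_comm z]
  have hc : ‖center F‖ = ‖q‖ := by simp [center, h, hs]
  have e1 : frac F.1 z - center F = s * z * (1 - q * conj q) / (1 + conj q * z) := by
    rw [center, h, h]
    field_simp
    ring
  have hq2 : ‖(1 : ℂ) - q * conj q‖ = 1 - ‖q‖ ^ 2 := by
    rw [Complex.mul_conj, Complex.normSq_eq_norm_sq, ← Complex.ofReal_one, ← Complex.ofReal_sub,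
      Complex.norm_real, Real.norm_of_nonneg]
    nlinarith [norm_nonneg q]
  have h0 : 0 ≤ 1 - ‖q‖ ^ 2 := by nlinarith [norm_nonneg q]
  have hden : 1 - ‖z‖ ≤ ‖1 + conj q * z‖ := by
    have h1 : ‖(1 : ℂ)‖ ≤ ‖1 + conj q * z‖ + ‖conj q * z‖ := by
      calc ‖(1 : ℂ)‖ = ‖(1 + conj q * z) - conj q * z‖ := by congr 1; ring
        _ ≤ _ := norm_sub_le _ _
    rw [norm_one, norm_mul (conj q), RCLike.norm_conj] at h1
    nlinarith [norm_nonneg q, norm_nonneg z]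
  rw [e1, norm_div, norm_mul, norm_mul, hs, one_mul, hq2, hc]
  have : ‖z‖ * (1 - ‖q‖ ^ 2) ≤ 1 - ‖q‖ ^ 2 := by nlinarith
  exact div_le_div₀ h0 this (by linarith) hden

/-! ### Weak* convergence from convergence of the centres -/

theorem integral_uniformMeasure {h : Circle → ℝ} (hh : Continuous h) :
    ∫ z, h z ∂uniformMeasure =
      (2 * Real.pi)⁻¹ • ∫ θ in (0)..(2 * Real.pi), h (Circle.exp θ) := by
  have hpi := Real.two_pi_pos
  rw [uniformMeasure, integral_smul_measure, ENNReal.toReal_ofReal (by positivity),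
    integral_map_of_stronglyMeasurable Circle.exp.continuous.measurable
      hh.stronglyMeasurable,
    intervalIntegral.integral_of_le hpi.le]

instance : IsProbabilityMeasure uniformMeasure := by
  have hpi := Real.two_pi_pos
  refine ⟨?_⟩
  rw [uniformMeasure, Measure.smul_apply,
    Measure.map_apply Circle.exp.continuous.measurable MeasurableSet.univ]
  simp only [Set.preimage_univ, Measure.restrict_apply_univ, Real.volume_Ioc, sub_zero,
    smul_eq_mul]
  rw [← ENNReal.ofReal_mul (by positivity), inv_mul_cancel₀ hpi.ne', ENNReal.ofReal_one]

theorem norm_sub_sq_circle (y x : Circle) :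
    ‖(y : ℂ) - x‖ ^ 2 = 2 - 2 * (conj (x : ℂ) * y).re := by
  have hx : Complex.normSq (x : ℂ) = 1 := Circle.normSq_coe x
  have hy : Complex.normSq (y : ℂ) = 1 := Circle.normSq_coe y
  rw [← Complex.normSq_eq_norm_sq]
  simp only [Complex.normSq_apply, Complex.sub_re, Complex.sub_im, Complex.mul_re,
    Complex.conj_re, Complex.conj_im] at hx hy ⊢
  linear_combination hx + hy

/-- The mean value property of the holomorphic function `frac F.1` makes the mean squared distance
to x depend on the image of the centre alone. -/
theorem integral_norm_circleMap_sub_sq (F : DiscMobius) (x : Circle) :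
    ∫ z, ‖(circleMap F z : ℂ) - x‖ ^ 2 ∂uniformMeasure =
      2 - 2 * (conj (x : ℂ) * center F).re := by
  have hF : Continuous fun z : Circle => (circleMap F z : ℂ) :=
    continuous_subtype_val.comp (continuous_circleMap F)
  have hint : ∀ h : Circle → ℝ, Continuous h → Integrable h uniformMeasure := fun h hh =>
    hh.integrable_of_hasCompactSupport (HasCompactSupport.of_compactSpace h)
  simp only [norm_sub_sq_circle]
  rw [integral_sub (integrable_const _) (hint _ (by fun_prop)), integral_const_mul]
  simp only [integral_const, probReal_univ, one_smul]
  congr 2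
  have hd : DiffContOnCl ℂ (fun z => conj (x : ℂ) * frac F.1 z) (Metric.ball 0 |1|) := by
    rw [abs_one]
    refine ⟨?_, ?_⟩
    · unfold frac
      refine DifferentiableOn.const_mul (DifferentiableOn.div (by fun_prop) (by fun_prop) ?_) _
      intro z hz
      exact denom_ne_zero F (by simpa using (Metric.mem_ball.1 hz).le)
    · rw [closure_ball _ one_ne_zero]
      exact continuousOn_const.mul (continuousOn_frac F)
  have hmv := hd.circleAverage
  have hci : CircleIntegrable (fun z => conj (x : ℂ) * frac F.1 z) 0 1 := by
    apply ContinuousOn.circleIntegrable zero_le_one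
    exact continuousOn_const.mul ((continuousOn_frac F).mono Metric.sphere_subset_closedBall)
  have hre := Complex.reCLM.circleAverage_comp_comm hci
  rw [hmv] at hre
  rw [integral_uniformMeasure (by fun_prop)]
  simp only [Complex.reCLM_apply] at hre
  rw [center, ← hre, Real.circleAverage_def]
  simp only [Function.comp_def, Complex.reCLM_apply, coe_circleMap, _root_.circleMap, zero_add,
    Complex.ofReal_one, one_mul, Circle.coe_exp]

/-- A sequence of transformations represents `x` if it moves the centre of the disc to `x`. -/
theorem represents_of_tendsto_center {F : ℕ → DiscMobius} {x : Circle}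
    (h : Tendsto (fun n => center (F n)) atTop (𝓝 (x : ℂ))) : Represents F x := by
  intro f
  have hint : ∀ h : Circle → ℝ, Continuous h → Integrable h uniformMeasure := fun h hh =>
    hh.integrable_of_hasCompactSupport (HasCompactSupport.of_compactSpace h)
  have hlim : Tendsto (fun n => 2 - 2 * (conj (x : ℂ) * center (F n)).re) atTop (𝓝 0) := by
    have h1 : Tendsto (fun n => 2 - 2 * (conj (x : ℂ) * center (F n)).re) atTop
        (𝓝 (2 - 2 * (conj (x : ℂ) * (x : ℂ)).re)) :=
      tendsto_const_nhds.sub (tendsto_const_nhds.mul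
        ((Complex.continuous_re.tendsto _).comp (tendsto_const_nhds.mul h)))
    convert h1 using 2
    have := norm_sub_sq_circle x x
    simp only [sub_self, norm_zero] at this
    linarith
  rw [integral_dirac, Metric.tendsto_atTop]
  intro ε hε
  obtain ⟨δ, hδ, hfδ⟩ := Metric.continuousAt_iff.1 f.continuous.continuousAt (ε / 2) (half_pos hε)
  -- Chebyshev's argument: continuity controls f near x, and at distance at least δ the bound 2‖f‖
  -- is absorbed by C times the squared distance.
  set C := 2 * ‖f‖ / δ ^ 2 with hC
  have hC0 : 0 ≤ C := by positivity
  have hbound : ∀ y : Circle, ‖f y - f x‖ ≤ ε / 2 + C * ‖(y : ℂ) - x‖ ^ 2 := by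
    intro y
    by_cases hy : dist y x < δ
    · have h1 := hfδ hy
      rw [Real.dist_eq] at h1
      have : 0 ≤ C * ‖(y : ℂ) - x‖ ^ 2 := by positivity
      rw [Real.norm_eq_abs]
      linarith
    · have hy' : δ ≤ ‖(y : ℂ) - x‖ := by
        rw [← dist_eq_norm]
        exact not_lt.1 hy
      have h1 : ‖f y - f x‖ ≤ 2 * ‖f‖ := by
        have := norm_sub_le (f y) (f x)
        linarith [f.norm_coe_le_norm y, f.norm_coe_le_norm x]
      have h2 : 2 * ‖f‖ ≤ C * ‖(y : ℂ) - x‖ ^ 2 := by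
        calc 2 * ‖f‖ = C * δ ^ 2 := by rw [hC]; field_simp
          _ ≤ _ := by gcongr
      linarith
  obtain ⟨N, hN⟩ := Metric.tendsto_atTop.1 hlim (ε / (2 * (C + 1))) (by positivity)
  refine ⟨N, fun n hn => ?_⟩
  have h1 := hN n hn
  rw [Real.dist_eq, sub_zero] at h1
  have hcm := continuous_circleMap (F n)
  have hF : Continuous fun z : Circle => (circleMap (F n) z : ℂ) :=
    continuous_subtype_val.comp hcm
  rw [integral_map hcm.measurable.aemeasurable
    f.continuous.stronglyMeasurable.aestronglyMeasurable, dist_eq_norm]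
  have e1 : (∫ z, f (circleMap (F n) z) ∂uniformMeasure) - f x =
      ∫ z, (f (circleMap (F n) z) - f x) ∂uniformMeasure := by
    rw [integral_sub (hint (fun z => f (circleMap (F n) z)) (by fun_prop)) (integrable_const _)]
    simp
  have h2 : ∫ z, (ε / 2 + C * ‖(circleMap (F n) z : ℂ) - x‖ ^ 2) ∂uniformMeasure =
      ε / 2 + C * (2 - 2 * (conj (x : ℂ) * center (F n)).re) := by
    rw [integral_add (integrable_const _) (hint _ (by fun_prop)), integral_const_mul,
      integral_norm_circleMap_sub_sq]
    simp
  rw [e1]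
  have h3 : ‖∫ z, (f (circleMap (F n) z) - f x) ∂uniformMeasure‖ ≤
      ∫ z, (ε / 2 + C * ‖(circleMap (F n) z : ℂ) - x‖ ^ 2) ∂uniformMeasure :=
    norm_integral_le_of_norm_le (hint _ (by fun_prop))
      (Eventually.of_forall fun z => hbound _)
  rw [h2] at h3
  have h4 : C * (2 - 2 * (conj (x : ℂ) * center (F n)).re) ≤ C * (ε / (2 * (C + 1))) :=
    mul_le_mul_of_nonneg_left (le_of_abs_le h1.le) hC0
  have h5 : C * (ε / (2 * (C + 1))) < ε / 2 := by
    rw [mul_div_assoc', div_lt_div_iff₀ (by positivity) two_pos]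
    nlinarith
  linarith

/-- Continuous functions separate points; this makes the choice in `valueMap` immaterial. -/
theorem Represents.unique {F : ℕ → DiscMobius} {x y : Circle} (hx : Represents F x)
    (hy : Represents F y) : x = y := by
  have h : ∀ f : C(Circle, ℝ), f x = f y := by
    intro f
    have := tendsto_nhds_unique (hx f) (hy f)
    simpa only [integral_dirac] using this
  have := h ⟨fun z => dist z y, by fun_prop⟩
  simpa using this

/-! ### Parabolic steps: size and sign of the shift -/

theorem kernel_eq_one_of_center_eq_zero {F : DiscMobius} (h : center F = 0) (x : Circle) :
    kernel F x = 1 := by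
  rw [kernel, h, add_zero, sub_zero, div_self x.coe_ne_zero]

theorem center_ne_zero_of_mem_expansionInterval {F : DiscMobius} {x : Circle}
    (hx : x ∈ expansionInterval F) : center F ≠ 0 := by
  intro h
  rw [mem_expansionInterval, kernel_eq_one_of_center_eq_zero h, Complex.one_re] at hx
  exact lt_irrefl _ hx

/-- The difference is 2p/(x - p), and |x - p| ≤ 2. This keeps the shifts away from 0 when the real
part is near 1. -/
theorem norm_center_le_norm_kernel_sub_one (F : DiscMobius) (x : Circle) :
    ‖center F‖ ≤ ‖kernel F x - 1‖ := by
  have hp := norm_center_lt F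
  have h0 : (x : ℂ) - center F ≠ 0 := sub_ne_zero.2 (coe_ne_of_norm_lt hp x)
  have e : kernel F x - 1 = 2 * center F / ((x : ℂ) - center F) := by
    rw [kernel]
    field_simp
    ring
  have h1 : ‖(x : ℂ) - center F‖ ≤ 2 := by
    have := norm_sub_le (x : ℂ) (center F)
    rw [x.norm_coe] at this
    linarith
  rw [e, norm_div, norm_mul, Complex.norm_two, le_div_iff₀ (norm_pos_iff.2 h0)]
  nlinarith [norm_nonneg (center F)]

theorem kernel_im_ne_zero {F : DiscMobius} {x : Circle} (h : center F ≠ 0)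
    (hx : (kernel F x).re = 1) : (kernel F x).im ≠ 0 := by
  intro h0
  have e : kernel F x = 1 := Complex.ext hx h0
  have := norm_center_le_norm_kernel_sub_one F x
  rw [e, sub_self, norm_zero] at this
  exact h (norm_le_zero_iff.1 this)

/-- The Cayley transform maps the circle to the imaginary axis. -/
theorem exists_cayley_eq {x y : Circle} (hxy : x ≠ y) : ∃ m : ℝ,
    ((x : ℂ) + y) / ((x : ℂ) - y) = m * Complex.I ∧ ‖(x : ℂ) - y‖ ^ 2 * (1 + m ^ 2) = 4 := by
  have h0 : (x : ℂ) - y ≠ 0 := sub_ne_zero.2 fun h => hxy (Circle.coe_injective h)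
  have hx := x.coe_ne_zero
  have hy := y.coe_ne_zero
  have hre : (((x : ℂ) + y) / ((x : ℂ) - y)).re = 0 := by
    have h1 : conj (((x : ℂ) + y) / ((x : ℂ) - y)) = -(((x : ℂ) + y) / ((x : ℂ) - y)) := by
      have h0' : (y : ℂ) - x ≠ 0 := by rw [← neg_sub]; exact neg_ne_zero.2 h0
      rw [map_div₀, map_add, map_sub, conj_coe_circle, conj_coe_circle]
      have e1 : (x : ℂ)⁻¹ - (y : ℂ)⁻¹ = (y - x) / (x * y) := by field_simp
      have e2 : (x : ℂ)⁻¹ + (y : ℂ)⁻¹ = (y + x) / (x * y) := by field_simp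
      rw [e1, e2, div_div_div_cancel_right₀ (mul_ne_zero hx hy), ← div_neg, neg_sub, add_comm]
    have h2 := congrArg Complex.re h1
    rw [Complex.conj_re, Complex.neg_re] at h2
    linarith
  refine ⟨(((x : ℂ) + y) / ((x : ℂ) - y)).im, ?_, ?_⟩
  · apply Complex.ext <;> simp [hre]
  · set K := ((x : ℂ) + y) / ((x : ℂ) - y) with hK
    have e : ((x : ℂ) - y) * (K + 1) = 2 * x := by
      rw [hK]
      field_simp
      ring
    have e2 := congrArg Complex.normSq e
    rw [Complex.normSq_mul, Complex.normSq_mul, Circle.normSq_coe, Complex.normSq_eq_norm_sq,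
      Complex.normSq_apply (K + 1)] at e2
    simp only [Complex.add_re, Complex.add_im, Complex.one_re, Complex.one_im, hre,
      Complex.normSq_ofNat] at e2
    linear_combination e2

/-- The expansion interval in the half plane model with an end point at infinity. -/
theorem sq_im_kernel_lt {F : DiscMobius} {x y : Circle} (hx : (kernel F x).re = 1)
    (hy : y ∈ expansionInterval F) {m : ℝ}
    (hxy : x ≠ y) (hm : ((x : ℂ) + y) / ((x : ℂ) - y) = m * Complex.I) :
    (kernel F x).im ^ 2 < 2 * m * (kernel F x).im := by
  have hp := norm_center_lt F
  set p := center F with hpdef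
  have hxp : (x : ℂ) - p ≠ 0 := sub_ne_zero.2 (coe_ne_of_norm_lt hp x)
  have hyp : (y : ℂ) - p ≠ 0 := sub_ne_zero.2 (coe_ne_of_norm_lt hp y)
  have hxy0 : (x : ℂ) - y ≠ 0 := sub_ne_zero.2 fun h => hxy (Circle.coe_injective h)
  have hx1 : 1 - ‖p‖ ^ 2 = ‖(x : ℂ) - p‖ ^ 2 := by
    rw [kernel_re_eq, div_eq_one_iff_eq (by positivity)] at hx
    exact hx
  have hy1 : ‖(y : ℂ) - p‖ ^ 2 < 1 - ‖p‖ ^ 2 := by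
    rw [mem_expansionInterval, kernel_re_eq, one_lt_div (by positivity)] at hy
    exact hy
  -- Expansion at y but only modulus 1 at x means |y - p| < |x - p|. Through this identity it says
  -- that K is closer to mi than 1 is; as Re K = 1, the inequality for Im K follows.
  have e : (kernel F x - m * Complex.I) * ((x : ℂ) - p) = (p - y) * (m * Complex.I + 1) := by
    rw [← hm, kernel, ← hpdef]
    field_simp
    ring
  have e2 := congrArg Complex.normSq e
  rw [Complex.normSq_mul, Complex.normSq_mul, Complex.normSq_eq_norm_sq (_ - p),
    Complex.normSq_eq_norm_sq (p - _), norm_sub_rev p, Complex.normSq_apply,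
    Complex.normSq_apply] at e2
  simp only [Complex.sub_re, Complex.sub_im, Complex.add_re, Complex.add_im, Complex.mul_re,
    Complex.mul_im, Complex.ofReal_re, Complex.ofReal_im, Complex.I_re, Complex.I_im,
    Complex.one_re, Complex.one_im, hx] at e2
  have hpos : 0 < ‖(x : ℂ) - p‖ ^ 2 := by positivity
  have h3 : ‖(x : ℂ) - p‖ ^ 2 * (1 + ((kernel F x).im - m) ^ 2) <
      ‖(x : ℂ) - p‖ ^ 2 * (1 + m ^ 2) := by
    have : ‖(y : ℂ) - p‖ ^ 2 * (1 + m ^ 2) < ‖(x : ℂ) - p‖ ^ 2 * (1 + m ^ 2) :=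
      mul_lt_mul_of_pos_right (by linarith) (by positivity)
    nlinarith
  have h4 := lt_of_mul_lt_mul_left h3 hpos.le
  linarith

/-- The set of points at which both factors of the inverse of a product are expanding. -/
def expansionPair (F G : DiscMobius) : Set Circle :=
  {y | y ∈ expansionInterval F ∧ circleMap F⁻¹ y ∈ expansionInterval G}

/-- At a point of modulus 1 for both steps, F is the translation by ν, so a nearby y has coordinates
m = m' + ν. Expansion at both steps gives m the sign of ν and m' the sign of ν'. If these differ, ν²
< 2mν yields 2|m'| < |ν|, although m' is large for y close to x. -/
theorem kernel_im_mul_pos {F G : DiscMobius} {x : Circle} (hx : x ∈ closure (expansionPair F G))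
    (hF : (kernel F x).re = 1) (hG : (kernel G (circleMap F⁻¹ x)).re = 1) :
    0 < (kernel F x).im * (kernel G (circleMap F⁻¹ x)).im := by
  obtain ⟨y₀, hy₀⟩ := closure_nonempty_iff.1 ⟨x, hx⟩
  have hF0 := kernel_im_ne_zero (center_ne_zero_of_mem_expansionInterval hy₀.1) hF
  have hG0 := kernel_im_ne_zero (center_ne_zero_of_mem_expansionInterval hy₀.2) hG
  set x' := circleMap F⁻¹ x with hx'
  set ν := (kernel F x).im with hν
  set ν' := (kernel G x').im with hν'
  by_contra hneg
  have hneg' : ν * ν' < 0 := lt_of_le_of_ne (not_lt.1 hneg) (mul_ne_zero hF0 hG0)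
  -- As |x' - y'|²(1 + m'²) = 4, this closeness is exactly |m'| > |ν|.
  obtain ⟨y, hyU, hyV, hyV'⟩ : ∃ y, ‖(x' : ℂ) - circleMap F⁻¹ y‖ ^ 2 * (1 + ν ^ 2) < 4 ∧
      y ∈ expansionInterval F ∧ circleMap F⁻¹ y ∈ expansionInterval G := by
    have hc : Continuous fun y : Circle =>
        ‖(x' : ℂ) - circleMap F⁻¹ y‖ ^ 2 * (1 + ν ^ 2) := by
      have := continuous_subtype_val.comp (continuous_circleMap F⁻¹)
      exact ((continuous_const.sub this).norm.pow 2).mul continuous_const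
    have hopen : IsOpen {y : Circle | ‖(x' : ℂ) - circleMap F⁻¹ y‖ ^ 2 * (1 + ν ^ 2) < 4} :=
      isOpen_lt hc continuous_const
    obtain ⟨y, h1, h2⟩ := mem_closure_iff.1 hx _ hopen (by simp [← hx'])
    exact ⟨y, h1, h2⟩
  set y' := circleMap F⁻¹ y with hy'
  have hxy : x ≠ y := by
    rintro rfl
    rw [mem_expansionInterval, hF] at hyV
    exact lt_irrefl _ hyV
  have ex : circleMap F x' = x := circleMap_circleMap_inv F x
  have ey : circleMap F y' = y := circleMap_circleMap_inv F y
  have hxy' : x' ≠ y' := fun h => hxy (by rw [← ex, ← ey, h])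
  obtain ⟨m, hm, -⟩ := exists_cayley_eq hxy
  obtain ⟨m', hm', hn'⟩ := exists_cayley_eq hxy'
  have hc := cayley_frac F x' y'.norm_coe.le fun h => hxy' (Circle.coe_injective h).symm
  rw [← coe_circleMap, ex, ey, hm, hm', hF, ← hν] at hc
  have hmm : m = m' + ν := by
    have := congrArg Complex.im hc
    simpa using this
  have h1 := sq_im_kernel_lt hF hyV hxy hm
  have h2 := sq_im_kernel_lt hG hyV' hxy' hm'
  rw [← hν] at h1
  rw [← hν'] at h2
  have h3 : ν ^ 2 < m' ^ 2 := by
    by_contra! hle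
    have hpos : 0 ≤ ‖(x' : ℂ) - y'‖ ^ 2 := by positivity
    nlinarith
  rcases lt_or_gt_of_ne hF0 with h | h
  · have h' : 0 < ν' := by nlinarith
    have hm1 : 0 < m' := by nlinarith
    have hm2 : 2 * m' < -ν := by nlinarith
    nlinarith
  · have h' : ν' < 0 := by nlinarith
    have hm1 : m' < 0 := by nlinarith
    have hm2 : -ν < 2 * m' := by nlinarith
    nlinarith

/-- On the compact set where the product is nonpositive, the sum of the two real parts exceeds 2 by
`kernel_im_mul_pos`, hence exceeds it uniformly. -/
theorem exists_kernel_im_mul_pos (F G : DiscMobius) : ∃ η > 0, ∀ x ∈ closure (expansionPair F G),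
    (kernel F x).re < 1 + η → (kernel G (circleMap F⁻¹ x)).re < 1 + η →
      0 < (kernel F x).im * (kernel G (circleMap F⁻¹ x)).im := by
  have hF := continuous_kernel F
  have hG := (continuous_kernel G).comp (continuous_circleMap F⁻¹)
  set C := closure (expansionPair F G) ∩
    {x | (kernel F x).im * (kernel G (circleMap F⁻¹ x)).im ≤ 0} with hC
  have hcl : IsClosed C := isClosed_closure.inter (isClosed_le
    ((Complex.continuous_im.comp hF).mul (Complex.continuous_im.comp hG)) continuous_const)
  have hone : ∀ x ∈ closure (expansionPair F G),
      1 ≤ (kernel F x).re ∧ 1 ≤ (kernel G (circleMap F⁻¹ x)).re := fun x hx =>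
    ⟨one_le_kernel_re_of_mem_closure (closure_mono (fun _ h => h.1) hx),
      one_le_kernel_re_of_mem_closure
        (map_mem_closure (continuous_circleMap F⁻¹) hx fun _ h => h.2)⟩
  obtain ⟨a, ha, hmin⟩ := hcl.isCompact.exists_forall_le'
    (f := fun x => (kernel F x).re + (kernel G (circleMap F⁻¹ x)).re) (a := 2)
    ((Complex.continuous_re.comp hF).add (Complex.continuous_re.comp hG)).continuousOn (by
      rintro x ⟨hx, hx'⟩
      obtain ⟨h1, h2⟩ := hone x hx
      by_contra! hle
      exact absurd (kernel_im_mul_pos hx (by linarith) (by linarith)) (not_lt.2 hx'))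
  refine ⟨(a - 2) / 2, by linarith, fun x hx h1 h2 => ?_⟩
  by_contra! hle
  have := hmin x ⟨hx, hle⟩
  linarith

/-! ### Expanding itineraries -/

section Dynamics

variable {ι : Type*}

theorem wordPrefix_succ (w : ℕ → ι) (n : ℕ) : wordPrefix w (n + 1) = wordPrefix w n ++ [w n] := by
  simp [wordPrefix, List.range_succ]

theorem wordPrefix_succ' (w : ℕ → ι) (n : ℕ) :
    wordPrefix w (n + 1) = w 0 :: wordPrefix (fun k => w (k + 1)) n := by
  simp [wordPrefix, List.range_succ_eq_map, Function.comp_def]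

theorem wordMap_append (G : ι → DiscMobius) (u v : List ι) :
    wordMap G (u ++ v) = wordMap G u * wordMap G v := by
  simp [wordMap]

theorem wordMap_singleton (G : ι → DiscMobius) (i : ι) : wordMap G [i] = G i := by
  simp [wordMap]

theorem wordMap_cons (G : ι → DiscMobius) (i : ι) (v : List ι) :
    wordMap G (i :: v) = G i * wordMap G v := by
  simp [wordMap]

theorem wordMap_wordPrefix_zero (G : ι → DiscMobius) (w : ℕ → ι) :
    wordMap G (wordPrefix w 0) = 1 := by
  simp [wordMap, wordPrefix]

theorem wordMap_wordPrefix_succ (G : ι → DiscMobius) (w : ℕ → ι) (n : ℕ) :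
    wordMap G (wordPrefix w (n + 1)) = wordMap G (wordPrefix w n) * G (w n) := by
  rw [wordPrefix_succ, wordMap_append, wordMap_singleton]

/-- The open set of the points that are expanded in each of the first `n` steps along `v`. -/
def expandingSet (G : ι → DiscMobius) (v : ℕ → ι) (n : ℕ) : Set Circle :=
  {y | ∀ k < n, circleMap (wordMap G (wordPrefix v k))⁻¹ y ∈ expansionInterval (G (v k))}

theorem circleMap_wordMap_succ_inv (G : ι → DiscMobius) (v : ℕ → ι) (n : ℕ) (y : Circle) :
    circleMap (wordMap G (wordPrefix v (n + 1)))⁻¹ y =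
      circleMap (G (v n))⁻¹ (circleMap (wordMap G (wordPrefix v n))⁻¹ y) := by
  rw [wordMap_wordPrefix_succ, mul_inv_rev, circleMap_mul]

theorem circleMap_mem_closure_expansionPair {G : ι → DiscMobius} {v : ℕ → ι} {x : Circle}
    (hx : ∀ n, x ∈ closure (expandingSet G v n)) (n : ℕ) :
    circleMap (wordMap G (wordPrefix v n))⁻¹ x ∈
      closure (expansionPair (G (v n)) (G (v (n + 1)))) := by
  refine map_mem_closure (continuous_circleMap _) (hx (n + 2)) fun y hy => ⟨hy n (by omega), ?_⟩
  have := hy (n + 1) (by omega)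
  rwa [circleMap_wordMap_succ_inv] at this

theorem tendsto_atTop_of_add_le_succ {N : ℕ → ℝ} {δ : ℝ} (hδ : 0 < δ) {n₀ : ℕ}
    (h : ∀ n ≥ n₀, N n + δ ≤ N (n + 1)) : Tendsto N atTop atTop := by
  rw [← tendsto_add_atTop_iff_nat n₀]
  have hle : ∀ k : ℕ, N n₀ + δ * k ≤ N (k + n₀) := by
    intro k
    induction k with
    | zero => simp
    | succ k ih =>
      have := h (k + n₀) (by omega)
      rw [show k + 1 + n₀ = k + n₀ + 1 by ring]
      push_cast
      linarith
  exact tendsto_atTop_mono hle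
    (tendsto_atTop_add_const_left _ _ (tendsto_natCast_atTop_atTop.const_mul_atTop hδ))

/-- Along an expanding sequence the kernels at the common point are unbounded: either the
derivatives tend to infinity, or the steps are asymptotically parabolic of a fixed direction. -/
theorem tendsto_norm_kernel [Finite ι] {G : ι → DiscMobius} {v : ℕ → ι} {x : Circle}
    (hx : ∀ n, x ∈ closure (expandingSet G v n)) :
    Tendsto (fun n => ‖kernel (wordMap G (wordPrefix v n)) x‖) atTop atTop := by
  set X : ℕ → Circle := fun n => circleMap (wordMap G (wordPrefix v n))⁻¹ x with hX
  set D : ℕ → ℝ := fun n => (kernel (wordMap G (wordPrefix v n)) x).re with hD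
  set N : ℕ → ℝ := fun n => (kernel (wordMap G (wordPrefix v n)) x).im with hN
  set d : ℕ → ℝ := fun n => (kernel (G (v n)) (X n)).re with hd
  set ν : ℕ → ℝ := fun n => (kernel (G (v n)) (X n)).im with hν
  have hpair : ∀ n, X n ∈ closure (expansionPair (G (v n)) (G (v (n + 1)))) :=
    circleMap_mem_closure_expansionPair hx
  have hXs : ∀ n, X (n + 1) = circleMap (G (v n))⁻¹ (X n) := fun n =>
    circleMap_wordMap_succ_inv G v n x
  have hDs : ∀ n, D (n + 1) = D n * d n := by
    intro n
    simp only [hD, hd, hX]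
    rw [wordMap_wordPrefix_succ, kernel_mul_re]
  have hNs : ∀ n, N (n + 1) = N n + D n * ν n := by
    intro n
    simp only [hN, hD, hν, hX]
    rw [wordMap_wordPrefix_succ, kernel_mul_im, add_comm]
  have hd1 : ∀ n, 1 ≤ d n := fun n =>
    one_le_kernel_re_of_mem_closure (closure_mono (fun _ h => h.1) (hpair n))
  have hD1 : ∀ n, 1 ≤ D n := by
    intro n
    induction n with
    | zero =>
      simp only [hD]
      rw [wordMap_wordPrefix_zero, kernel_eq_one_of_center_eq_zero (by rw [center, frac_one])]
      simp
    | succ n ih =>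
      rw [hDs]
      exact one_le_mul_of_one_le_of_one_le ih (hd1 n)
  have hmono : Monotone D := monotone_nat_of_le_succ fun n => by
    rw [hDs]
    exact le_mul_of_one_le_right (by linarith [hD1 n]) (hd1 n)
  rcases tendsto_atTop_of_monotone hmono with htop | ⟨L, hL⟩
  · exact tendsto_atTop_mono (fun n => Complex.re_le_norm _) htop
  have hL1 : 1 ≤ L := ge_of_tendsto' hL hD1
  -- Bounded case: D converges to a nonzero limit, so its ratios d tend to 1.
  have hdlim : Tendsto d atTop (𝓝 1) := by
    have h1 : Tendsto (fun n => D (n + 1) / D n) atTop (𝓝 (L / L)) :=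
      ((tendsto_add_atTop_iff_nat 1).2 hL).div hL (by linarith)
    rw [div_self (by linarith : L ≠ 0)] at h1
    refine h1.congr fun n => ?_
    rw [hDs, mul_div_cancel_left₀]
    linarith [hD1 n]
  have hcen : ∀ n, center (G (v n)) ≠ 0 := by
    intro n
    obtain ⟨y, hy⟩ := closure_nonempty_iff.1 ⟨_, hpair n⟩
    exact center_ne_zero_of_mem_expansionInterval hy.1
  -- Of the lower bound 2δ for |K - 1|, at most δ is used up by the real part, which leaves |ν| ≥ δ.
  obtain ⟨δ, hδ, hδle⟩ : ∃ δ > 0, ∀ i, center (G i) ≠ 0 → 2 * δ ≤ ‖center (G i)‖ := by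
    have hev : ∀ᶠ δ : ℝ in 𝓝[>] 0, ∀ i, center (G i) ≠ 0 → 2 * δ ≤ ‖center (G i)‖ := by
      refine eventually_all.2 fun i => ?_
      by_cases hi : center (G i) = 0
      · exact Eventually.of_forall fun _ h => absurd hi h
      · filter_upwards [Ioo_mem_nhdsGT (half_pos (norm_pos_iff.2 hi))] with δ hδ _
        linarith [hδ.2]
    exact ((eventually_mem_nhdsWithin).and hev).exists
  choose η hη hηs using exists_kernel_im_mul_pos
  have hev : ∀ᶠ n in atTop, d n < 1 + δ ∧ ∀ i j, d n < 1 + η (G i) (G j) :=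
    (hdlim.eventually_lt_const (by linarith)).and
      (eventually_all.2 fun i => eventually_all.2 fun j =>
        hdlim.eventually_lt_const (by linarith [hη (G i) (G j)]))
  obtain ⟨n₀, hn₀⟩ := eventually_atTop.1 hev
  have hνδ : ∀ n ≥ n₀, δ ≤ |ν n| := by
    intro n hn
    have h1 := norm_center_le_norm_kernel_sub_one (G (v n)) (X n)
    have h2 := Complex.norm_le_abs_re_add_abs_im (kernel (G (v n)) (X n) - 1)
    have h3 : |(kernel (G (v n)) (X n) - 1).re| ≤ δ := by
      rw [Complex.sub_re, Complex.one_re, abs_of_nonneg (by linarith [hd1 n])]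
      linarith [(hn₀ n hn).1]
    have h4 : (kernel (G (v n)) (X n) - 1).im = ν n := by simp [hν]
    rw [h4] at h2
    linarith [hδle _ (hcen n)]
  have hsign : ∀ n ≥ n₀, 0 < ν n * ν (n + 1) := by
    intro n hn
    have h1 := hηs _ _ _ (hpair n) ((hn₀ n hn).2 _ _)
    rw [← hXs] at h1
    exact h1 ((hn₀ (n + 1) (by omega)).2 _ _)
  -- The shifts have a constant sign from n₀ on and are scaled by D ≥ 1, so N moves by at least δ
  -- per step in one direction.
  have habs : Tendsto (fun n => |N n|) atTop atTop := by
    rcases le_total 0 (ν n₀) with h0 | h0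
    · have hpos : ∀ n ≥ n₀, 0 ≤ ν n := by
        intro n hn
        induction n, hn using Nat.le_induction with
        | base => exact h0
        | succ n hn ih => nlinarith [hsign n hn]
      refine tendsto_abs_atTop_atTop.comp (tendsto_atTop_of_add_le_succ hδ (n₀ := n₀) ?_)
      intro n hn
      have := hνδ n hn
      rw [abs_of_nonneg (hpos n hn)] at this
      rw [hNs]
      nlinarith [hD1 n]
    · have hneg : ∀ n ≥ n₀, ν n ≤ 0 := by
        intro n hn
        induction n, hn using Nat.le_induction with
        | base => exact h0
        | succ n hn ih => nlinarith [hsign n hn]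
      have : Tendsto (fun n => -N n) atTop atTop := by
        refine tendsto_atTop_of_add_le_succ hδ (n₀ := n₀) ?_
        intro n hn
        have := hνδ n hn
        rw [abs_of_nonpos (hneg n hn)] at this
        rw [hNs]
        nlinarith [hD1 n]
      simpa only [Function.comp_def, abs_neg] using tendsto_abs_atTop_atTop.comp this
  exact tendsto_atTop_mono (fun n => Complex.abs_im_le_norm _) habs

/-- Here |x - p| |K| = |x + p| ≤ 2. -/
theorem tendsto_center_of_tendsto_norm_kernel {F : ℕ → DiscMobius} {x : Circle}
    (h : Tendsto (fun n => ‖kernel (F n) x‖) atTop atTop) :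
    Tendsto (fun n => center (F n)) atTop (𝓝 (x : ℂ)) := by
  rw [tendsto_iff_norm_sub_tendsto_zero]
  refine squeeze_zero' (Eventually.of_forall fun n => norm_nonneg _) ?_
    (tendsto_const_nhds.div_atTop h : Tendsto (fun n => 2 / ‖kernel (F n) x‖) atTop (𝓝 0))
  filter_upwards [h.eventually_gt_atTop 0] with n hn
  have hp := norm_center_lt (F n)
  rw [le_div_iff₀ hn, kernel, norm_div, norm_sub_rev, mul_div_cancel₀]
  · have := norm_add_le (x : ℂ) (center (F n))
    rw [x.norm_coe] at this
    linarith
  · exact norm_ne_zero_iff.2 (sub_ne_zero.2 (coe_ne_of_norm_lt hp x))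

theorem tendsto_center_wordMap [Finite ι] {G : ι → DiscMobius} {v : ℕ → ι} {x : Circle}
    (hx : ∀ n, x ∈ closure (expandingSet G v n)) :
    Tendsto (fun n => center (wordMap G (wordPrefix v n))) atTop (𝓝 (x : ℂ)) :=
  tendsto_center_of_tendsto_norm_kernel (tendsto_norm_kernel hx)

/-- At such points the modulus is 1, which, with ȳ = 1/y, is a polynomial equation of degree two in
y, nontrivial as p ≠ 0. -/
theorem finite_closure_sdiff_expansionInterval (F : DiscMobius) :
    (closure (expansionInterval F) \ expansionInterval F).Finite := by
  by_cases hp : center F = 0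
  · have : expansionInterval F = ∅ := Set.eq_empty_of_forall_notMem fun y hy =>
      center_ne_zero_of_mem_expansionInterval hy hp
    simp [this]
  set p := center F with hpdef
  let P : Polynomial ℂ := Polynomial.C (conj p) * Polynomial.X ^ 2 -
    Polynomial.C (2 * (p * conj p)) * Polynomial.X + Polynomial.C p
  have hP : P ≠ 0 := fun h => hp (by simpa [P] using congrArg (Polynomial.eval 0) h)
  refine ((Polynomial.finite_setOfPred_isRoot hP).preimage
    (Circle.coe_injective.injOn)).subset ?_
  intro (y : Circle) hyd
  obtain ⟨hy, hy'⟩ := hyd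
  have hre : (kernel F y).re = 1 :=
    le_antisymm (not_lt.1 fun h => hy' ((mem_expansionInterval F y).2 h))
      (one_le_kernel_re_of_mem_closure hy)
  have hyp : (y : ℂ) - p ≠ 0 := sub_ne_zero.2 (coe_ne_of_norm_lt (norm_center_lt F) y)
  rw [kernel_re_eq, div_eq_one_iff_eq (by positivity), ← hpdef, ← Complex.normSq_eq_norm_sq,
    ← Complex.normSq_eq_norm_sq] at hre
  have h2 := congrArg (fun r : ℝ => (r : ℂ)) hre
  simp only [Complex.ofReal_sub, Complex.ofReal_one, ← Complex.mul_conj, map_sub,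
    conj_coe_circle] at h2
  have hy0 := y.coe_ne_zero
  field_simp at h2
  change Polynomial.eval (y : ℂ) P = 0
  simp only [P, Polynomial.eval_add, Polynomial.eval_sub, Polynomial.eval_mul, Polynomial.eval_C,
    Polynomial.eval_pow, Polynomial.eval_X]
  linear_combination h2

/-- Every point of the circle has an expanding itinerary. -/
theorem exists_forall_mem_closure_expandingSet [Finite ι] {G : ι → DiscMobius}
    (hG : Set.univ ⊆ ⋃ i, closure (expansionInterval (G i))) (x : Circle) :
    ∃ v : ℕ → ι, ∀ n, x ∈ closure (expandingSet G v n) := by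
  have : Nontrivial Circle := ⟨⟨1, -1, fun h => Circle.neg_ne_self 1 h.symm⟩⟩
  -- A single ultrafilter of points y ≠ x tending to x makes all choices compatible: it avoids
  -- finite sets, hence the end points, so at each step one of the finitely many open intervals is
  -- `U`-large, and finitely many such conditions hold together.
  set U : Ultrafilter Circle := Ultrafilter.of (𝓝[≠] x)
  have hUle : (U : Filter Circle) ≤ 𝓝[≠] x := Ultrafilter.of_le _
  have hUcof : ∀ s : Set Circle, s.Finite → sᶜ ∈ U := fun s hs =>
    hUle (nhdsNE_le_cofinite x hs.compl_mem_cofinite)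
  have hstep : ∀ g : DiscMobius, ∃ i, {y | circleMap g⁻¹ y ∈ expansionInterval (G i)} ∈ U := by
    intro g
    have hinj : Function.Injective (circleMap g⁻¹) := fun y z h => by
      rw [← circleMap_circleMap_inv g y, h, circleMap_circleMap_inv]
    have hfin : (⋃ i, circleMap g⁻¹ ⁻¹'
        (closure (expansionInterval (G i)) \ expansionInterval (G i))).Finite :=
      Set.finite_iUnion fun i =>
        (finite_closure_sdiff_expansionInterval (G i)).preimage hinj.injOn
    have hmem : (⋃ i ∈ (Set.univ : Set ι), {y | circleMap g⁻¹ y ∈ expansionInterval (G i)}) ∈ U := by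
      refine mem_of_superset (hUcof _ hfin) fun y hy => ?_
      obtain ⟨i, hi⟩ := Set.mem_iUnion.1 (hG (Set.mem_univ (circleMap g⁻¹ y)))
      refine Set.mem_biUnion (Set.mem_univ i) ?_
      by_contra hn
      exact hy (Set.mem_iUnion.2 ⟨i, hi, hn⟩)
    obtain ⟨i, -, hi⟩ := (Ultrafilter.finite_biUnion_mem_iff Set.finite_univ).1 hmem
    exact ⟨i, hi⟩
  choose c hc using hstep
  let g : ℕ → DiscMobius := fun n => Nat.rec 1 (fun _ h => h * G (c h)) n
  have hg : ∀ n, wordMap G (wordPrefix (fun k => c (g k)) n) = g n := by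
    intro n
    induction n with
    | zero => exact wordMap_wordPrefix_zero _ _
    | succ n ih => rw [wordMap_wordPrefix_succ, ih]
  refine ⟨fun k => c (g k), fun n => ?_⟩
  rw [mem_closure_iff_ultrafilter]
  refine ⟨U, ?_, hUle.trans nhdsWithin_le_nhds⟩
  have : expandingSet G (fun k => c (g k)) n =
      ⋂ k ∈ Set.Iio n, {y | circleMap (g k)⁻¹ y ∈ expansionInterval (G (c (g k)))} := by
    ext y
    simp [expandingSet, hg]
  rw [this]
  exact (biInter_mem (Set.finite_Iio n)).2 fun k _ => hc (g k)

theorem circleMap_inv_mem_closure_expandingSet {G : ι → DiscMobius} {v : ℕ → ι} {x : Circle}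
    (hx : ∀ n, x ∈ closure (expandingSet G v n)) (n : ℕ) :
    circleMap (G (v 0))⁻¹ x ∈ closure (expandingSet G (fun k => v (k + 1)) n) := by
  refine map_mem_closure (continuous_circleMap _) (hx (n + 1)) fun y hy k hk => ?_
  have := hy (k + 1) (by omega)
  rwa [wordPrefix_succ', wordMap_cons, mul_inv_rev, circleMap_mul] at this

theorem eventually_forall_lt_eq [TopologicalSpace ι] [DiscreteTopology ι] (v : ℕ → ι) (n : ℕ) :
    ∀ᶠ w in 𝓝 v, ∀ k < n, v k = w k := by
  have : {w : ℕ → ι | ∀ k < n, v k = w k} = ⋂ k ∈ Set.Iio n, {w | v k = w k} := by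
    ext w; simp
  change {w : ℕ → ι | ∀ k < n, v k = w k} ∈ 𝓝 v
  rw [this]
  refine (biInter_mem (Set.finite_Iio n)).2 fun k _ => ?_
  exact (continuous_apply k).continuousAt.preimage_mem_nhds
    (show {a | v k = a} ∈ 𝓝 (v k) from mem_nhds_discrete.2 rfl)

theorem wordPrefix_congr {v w : ℕ → ι} {n : ℕ} (h : ∀ k < n, v k = w k) :
    wordPrefix v n = wordPrefix w n :=
  List.map_congr_left fun i hi => h i (List.mem_range.1 hi)

/-- The n-th condition depends only on the first n letters, so it is locally constant in the
itinerary. -/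
theorem isClosed_setOf_mem_closure_expandingSet [TopologicalSpace ι] [DiscreteTopology ι]
    (G : ι → DiscMobius) :
    IsClosed {q : (ℕ → ι) × Circle | ∀ n, q.2 ∈ closure (expandingSet G q.1 n)} := by
  rw [Set.ofPred_forall]
  refine isClosed_iInter fun n => ?_
  have hlocal : ∀ v w : ℕ → ι, (∀ k < n, v k = w k) → expandingSet G v n = expandingSet G w n := by
    intro v w h
    ext y
    refine forall₂_congr fun k hk => ?_
    rw [wordPrefix_congr fun j hj => h j (hj.trans hk), h k hk]
  rw [← isOpen_compl_iff, isOpen_iff_mem_nhds]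
  rintro ⟨v, x⟩ hvx
  have h1 := eventually_forall_lt_eq v n
  have h2 : (closure (expandingSet G v n))ᶜ ∈ 𝓝 x := isClosed_closure.isOpen_compl.mem_nhds hvx
  filter_upwards [prod_mem_nhds h1 h2] with q hq
  have := hq.2
  rwa [hlocal v q.1 hq.1] at this

end Dynamics

/-! ### From blocks to letters -/

section Concatenation

variable {A ι : Type*}

theorem wordPrefix_add (u : ℕ → A) (k n : ℕ) :
    wordPrefix u (k + n) = wordPrefix u k ++ wordPrefix (fun j => u (k + j)) n := by
  simp [wordPrefix, List.range_add, Function.comp_def]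

theorem length_wordPrefix (u : ℕ → A) (n : ℕ) : (wordPrefix u n).length = n := by
  simp [wordPrefix]

theorem wordMap_flatMap (F : A → DiscMobius) (b : ι → List A) (l : List ι) :
    wordMap F (l.flatMap b) = wordMap (fun i => wordMap F (b i)) l := by
  induction l with
  | nil => simp [wordMap]
  | cons i l ih => rw [List.flatMap_cons, wordMap_append, wordMap_cons, ih]

theorem le_length_flatMap_wordPrefix {b : ι → List A} (hb : ∀ i, b i ≠ []) (v : ℕ → ι) (n : ℕ) :
    n ≤ ((wordPrefix v n).flatMap b).length := by
  induction n with
  | zero => exact Nat.zero_le _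
  | succ n ih =>
    have := List.length_pos_iff.2 (hb (v n))
    rw [wordPrefix_succ, List.flatMap_append, List.length_append, List.flatMap_singleton]
    omega

/-- The infinite concatenation of the words `b (v 0)`, `b (v 1)`, … -/
def concatWord (b : ι → List A) (hb : ∀ i, b i ≠ []) (v : ℕ → ι) (k : ℕ) : A :=
  ((wordPrefix v (k + 1)).flatMap b)[k]'(le_length_flatMap_wordPrefix hb v (k + 1))

theorem flatMap_wordPrefix_isPrefix (b : ι → List A) (v : ℕ → ι) {m n : ℕ} (h : m ≤ n) :
    (wordPrefix v m).flatMap b <+: (wordPrefix v n).flatMap b := by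
  obtain ⟨k, rfl⟩ := Nat.exists_eq_add_of_le h
  rw [wordPrefix_add, List.flatMap_append]
  exact List.prefix_append _ _

theorem getElem_flatMap_wordPrefix {b : ι → List A} (hb : ∀ i, b i ≠ []) (v : ℕ → ι) {n k : ℕ}
    (hk : k < ((wordPrefix v n).flatMap b).length) :
    ((wordPrefix v n).flatMap b)[k] = concatWord b hb v k := by
  rw [concatWord]
  rcases le_total n (k + 1) with h | h
  · exact (flatMap_wordPrefix_isPrefix b v h).getElem hk
  · exact ((flatMap_wordPrefix_isPrefix b v h).getElem
      (le_length_flatMap_wordPrefix hb v (k + 1))).symm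

theorem wordPrefix_concatWord {b : ι → List A} (hb : ∀ i, b i ≠ []) (v : ℕ → ι) {n m : ℕ}
    (hm : m ≤ ((wordPrefix v n).flatMap b).length) :
    wordPrefix (concatWord b hb v) m = ((wordPrefix v n).flatMap b).take m := by
  refine List.ext_getElem ?_ fun k h1 h2 => ?_
  · rw [length_wordPrefix, List.length_take, min_eq_left hm]
  · rw [List.getElem_take, getElem_flatMap_wordPrefix hb]
    simp [wordPrefix]

theorem concatWord_add_length {b : ι → List A} (hb : ∀ i, b i ≠ []) (v : ℕ → ι) (k : ℕ) :
    concatWord b hb v ((b (v 0)).length + k) = concatWord b hb (fun j => v (j + 1)) k := by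
  have hk := le_length_flatMap_wordPrefix hb (fun j => v (j + 1)) (k + 1)
  have e : (wordPrefix v (k + 1 + 1)).flatMap b =
      b (v 0) ++ (wordPrefix (fun j => v (j + 1)) (k + 1)).flatMap b := by
    rw [wordPrefix_succ', List.flatMap_cons]
  rw [← getElem_flatMap_wordPrefix hb v (n := k + 1 + 1) (by rw [e, List.length_append]; omega),
    concatWord]
  simp only [e]
  rw [List.getElem_append_right (by omega)]
  congr 1
  omega

theorem eventually_concatWord_eq [TopologicalSpace ι] [DiscreteTopology ι] {b : ι → List A}
    (hb : ∀ i, b i ≠ []) (v : ℕ → ι) (n : ℕ) :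
    ∀ᶠ w in 𝓝 v, ∀ k < n, concatWord b hb v k = concatWord b hb w k := by
  filter_upwards [eventually_forall_lt_eq v n] with w hw k hk
  have : wordPrefix v (k + 1) = wordPrefix w (k + 1) :=
    wordPrefix_congr fun j hj => hw j (by omega)
  simp only [concatWord, this]

theorem continuous_concatWord [TopologicalSpace ι] [DiscreteTopology ι] [TopologicalSpace A]
    {b : ι → List A} (hb : ∀ i, b i ≠ []) : Continuous (concatWord b hb) := by
  refine continuous_pi fun k => continuous_iff_continuousAt.2 fun v => ?_
  refine continuousAt_const.congr (f := fun _ => concatWord b hb v k) ?_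
  filter_upwards [eventually_concatWord_eq hb v (k + 1)] with w hw
  exact hw k (Nat.lt_succ_self k)

/-- The image of a fixed interior point stays close to the image of the centre as the latter
approaches the circle. -/
theorem tendsto_center_mul {F : ℕ → DiscMobius} {x : Circle} (h : DiscMobius)
    (hF : Tendsto (fun n => center (F n)) atTop (𝓝 (x : ℂ))) :
    Tendsto (fun n => center (F n * h)) atTop (𝓝 (x : ℂ)) := by
  have hlim : Tendsto (fun n => (1 - ‖center (F n)‖ ^ 2) / (1 - ‖center h‖)) atTop (𝓝 0) := by
    have := (tendsto_const_nhds (x := (1 : ℝ)).sub (hF.norm.pow 2)).div_const (1 - ‖center h‖)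
    simpa [x.norm_coe] using this
  have h0 : Tendsto (fun n => center (F n * h) - center (F n)) atTop (𝓝 0) := by
    refine squeeze_zero_norm (fun n => ?_) hlim
    rw [center_mul]
    exact norm_frac_sub_center_le (F n) (norm_center_lt h)
  simpa using h0.add hF

/-- The convergence along the prefixes that consist of complete blocks implies convergence along
all prefixes. -/
theorem tendsto_center_concatWord [Finite ι] (F : A → DiscMobius) {b : ι → List A}
    (hb : ∀ i, b i ≠ []) {v : ℕ → ι} {x : Circle}
    (h : Tendsto (fun n => center (wordMap (fun i => wordMap F (b i)) (wordPrefix v n))) atTop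
      (𝓝 (x : ℂ))) :
    Tendsto (fun m => center (wordMap F (wordPrefix (concatWord b hb v) m))) atTop
      (𝓝 (x : ℂ)) := by
  rw [tendsto_iff_forall_eventually_mem]
  intro s hs
  -- A prefix is a run of complete blocks followed by part of one block, and only finitely many such
  -- parts exist.
  have hev : ∀ᶠ n in atTop, ∀ i, ∀ l ∈ Finset.range (b i).length,
      center (wordMap (fun i => wordMap F (b i)) (wordPrefix v n) *
        wordMap F ((b i).take l)) ∈ s :=
    eventually_all.2 fun i => (eventually_all_finset _).2 fun l _ =>
      (tendsto_center_mul _ h).eventually_mem hs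
  obtain ⟨J, hJ⟩ := eventually_atTop.1 hev
  set L : ℕ → ℕ := fun n => ((wordPrefix v n).flatMap b).length with hL
  have hLs : ∀ n, L (n + 1) = L n + (b (v n)).length := by
    intro n
    simp only [hL]
    rw [wordPrefix_succ, List.flatMap_append, List.length_append, List.flatMap_singleton]
  refine eventually_atTop.2 ⟨L J, fun m hm => ?_⟩
  obtain ⟨j, hj, l, hl, rfl⟩ : ∃ j ≥ J, ∃ l < (b (v j)).length, m = L j + l := by
    induction m, hm using Nat.le_induction with
    | base => exact ⟨J, le_rfl, 0, List.length_pos_iff.2 (hb _), rfl⟩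
    | succ m hm ih =>
      obtain ⟨j, hj, l, hl, rfl⟩ := ih
      rcases Nat.lt_or_ge (l + 1) (b (v j)).length with hlt | hge
      · exact ⟨j, hj, l + 1, hlt, rfl⟩
      · exact ⟨j + 1, by omega, 0, List.length_pos_iff.2 (hb _), by rw [hLs]; omega⟩
  rw [wordPrefix_concatWord hb v (n := j + 1) (by change _ ≤ L (j + 1); rw [hLs]; omega),
    wordPrefix_succ, List.flatMap_append, List.flatMap_singleton, List.take_length_add_append,
    wordMap_append, wordMap_flatMap]
  exact hJ j hj (v j) l (Finset.mem_range.2 hl)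

end Concatenation

/-! ### Construction of the subshift -/

section Systems

variable {A : Type*}

theorem valueMap_eq {F : A → DiscMobius} {w : representingWords F} {x : Circle}
    (h : Represents (fun n => wordMap F (wordPrefix w.1 n)) x) : valueMap F w = x :=
  Represents.unique w.2.choose_spec h

/-- A compact relation between infinite words and the points that they represent is the graph of
the value map of a Möbius number system, if its domain is shift invariant and its range is the
circle. -/
theorem exists_isMobiusNumberSystem_of_isCompact [TopologicalSpace A] [DiscreteTopology A]
    {F : A → DiscMobius} {Γ : Set ((ℕ → A) × Circle)} (hΓ : IsCompact Γ)
    (hrep : ∀ u y, (u, y) ∈ Γ → Represents (fun n => wordMap F (wordPrefix u n)) y)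
    (hshift : ∀ u y, (u, y) ∈ Γ → ∃ z, (fun k => u (1 + k), z) ∈ Γ)
    (hsurj : ∀ y, ∃ u, (u, y) ∈ Γ) :
    ∃ S : SymbolicDynamics.FullShift.Subshift A ℕ, IsMobiusNumberSystem F S := by
  refine ⟨⟨Prod.fst '' Γ, (hΓ.image continuous_fst).isClosed, ?_⟩, ?_, ?_, ?_⟩
  · intro g
    induction g with
    | zero =>
      rintro _ ⟨⟨u, y⟩, h, rfl⟩
      exact ⟨(u, y), h, by ext k; simp⟩
    | succ g ih =>
      intro u hu
      obtain ⟨⟨w, y⟩, h, hw⟩ := ih hu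
      obtain ⟨z, hz⟩ := hshift w y h
      refine ⟨_, hz, ?_⟩
      ext k
      change w = _ at hw
      simp only [hw, SymbolicDynamics.FullShift.shift_apply, add_assoc]
  · rintro _ ⟨⟨u, y⟩, h, rfl⟩
    exact ⟨y, hrep u y h⟩
  · refine Set.eq_univ_of_forall fun y => ?_
    obtain ⟨u, hu⟩ := hsurj y
    exact ⟨⟨u, y, hrep u y hu⟩, ⟨(u, y), hu, rfl⟩, valueMap_eq (hrep u y hu)⟩
  · rw [continuousOn_iff_isClosed]
    intro t ht
    -- The preimage of the closed set t is the projection of a compact part of Γ; uniqueness of the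
    -- represented point identifies the two.
    refine ⟨Subtype.val ⁻¹' (Prod.fst '' (Γ ∩ Prod.snd ⁻¹' t)),
      ((hΓ.inter_right (ht.preimage continuous_snd)).image continuous_fst).isClosed.preimage
        continuous_subtype_val, ?_⟩
    ext w
    constructor
    · rintro ⟨hw, ⟨⟨u, y⟩, h, rfl⟩⟩
      refine ⟨⟨(_, y), ⟨h, ?_⟩, rfl⟩, ⟨_, h, rfl⟩⟩
      rw [Set.mem_preimage, valueMap_eq (hrep _ _ h)] at hw
      exact hw
    · rintro ⟨⟨⟨u, y⟩, ⟨h, hy⟩, hu⟩, hw⟩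
      refine ⟨?_, hw⟩
      change u = _ at hu
      subst hu
      rw [Set.mem_preimage, valueMap_eq (hrep _ _ h)]
      exact hy

/-- Expanding itineraries with respect to finitely many nonempty words yield a Möbius number
system. -/
theorem exists_isMobiusNumberSystem_of_cover [TopologicalSpace A] [DiscreteTopology A]
    (F : A → DiscMobius) {ι : Type*} [Finite ι] {b : ι → List A} (hb : ∀ i, b i ≠ [])
    (hcov : Set.univ ⊆ ⋃ i, closure (expansionInterval (wordMap F (b i)))) :
    ∃ S : SymbolicDynamics.FullShift.Subshift A ℕ, IsMobiusNumberSystem F S := by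
  let _ : TopologicalSpace ι := ⊥
  have : DiscreteTopology ι := ⟨rfl⟩
  set G : ι → DiscMobius := fun i => wordMap F (b i)
  set Z : Set ((ℕ → ι) × Circle) := {q | ∀ n, q.2 ∈ closure (expandingSet G q.1 n)} with hZ
  have hZc : IsCompact Z := (isClosed_setOf_mem_closure_expandingSet G).isCompact
  obtain ⟨K, hK⟩ : ∃ K, ∀ i, (b i).length ≤ K := by
    obtain ⟨K, hK⟩ := (Set.finite_range fun i => (b i).length).bddAbove
    exact ⟨K, fun i => hK ⟨i, rfl⟩⟩
  -- Concatenations alone are not shift invariant, so k initial letters are dropped, and the point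
  -- is moved by the inverse of the map of the dropped prefix.
  set φ : ℕ → (ℕ → ι) × Circle → (ℕ → A) × Circle := fun k q =>
    (fun j => concatWord b hb q.1 (k + j),
      circleMap (wordMap F (wordPrefix (concatWord b hb q.1) k))⁻¹ q.2) with hφ
  have hφc : ∀ k, Continuous (φ k) := by
    intro k
    refine Continuous.prodMk ?_ (continuous_iff_continuousAt.2 ?_)
    · exact continuous_pi fun j =>
        (continuous_apply (k + j)).comp ((continuous_concatWord hb).comp continuous_fst)
    · rintro ⟨v, x⟩
      refine ContinuousAt.congr (f := fun q : (ℕ → ι) × Circle =>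
        circleMap (wordMap F (wordPrefix (concatWord b hb v) k))⁻¹ q.2)
        ((continuous_circleMap _).comp continuous_snd).continuousAt ?_
      filter_upwards [continuous_fst.continuousAt.eventually (eventually_concatWord_eq hb v k)]
        with q hq
      rw [wordPrefix_congr hq]
  refine exists_isMobiusNumberSystem_of_isCompact (F := F) (Γ := ⋃ k ∈ Set.Iic K, φ k '' Z)
    ((Set.finite_Iic K).isCompact_biUnion fun k _ => hZc.image (hφc k)) ?_ ?_ ?_
  · intro u y hu
    obtain ⟨k, -, ⟨v, x⟩, hvx, he⟩ := Set.mem_iUnion₂.1 hu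
    obtain ⟨rfl, rfl⟩ := Prod.mk.inj he
    apply represents_of_tendsto_center
    have h1 := tendsto_center_concatWord F hb (tendsto_center_wordMap hvx)
    rw [← tendsto_add_atTop_iff_nat k] at h1
    have hx : (x : ℂ) ∈ Metric.closedBall (0 : ℂ) 1 := by simpa using x.norm_coe.le
    -- Undoing the dropped prefix is continuous on the closed disc, so convergence of the centres
    -- survives.
    have h2 := (continuousOn_frac (wordMap F (wordPrefix (concatWord b hb v) k))⁻¹ _ hx).tendsto.comp
      (tendsto_nhdsWithin_iff.2 ⟨h1, Eventually.of_forall fun n => by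
        simpa using (norm_center_lt _).le⟩)
    refine h2.congr fun n => ?_
    rw [Function.comp_apply, ← center_mul, add_comm n k, wordPrefix_add, wordMap_append,
      inv_mul_cancel_left]
  · intro u y hu
    obtain ⟨k, hk, ⟨v, x⟩, hvx, he⟩ := Set.mem_iUnion₂.1 hu
    obtain ⟨rfl, rfl⟩ := Prod.mk.inj he
    rcases Nat.lt_or_ge k K with hlt | hge
    · refine ⟨_, Set.mem_iUnion₂.2 ⟨k + 1, hlt, (v, x), hvx, Prod.ext ?_ rfl⟩⟩
      simp only [hφ, add_assoc]
    · have hk1 : k + 1 - (b (v 0)).length ≤ K := by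
        have := List.length_pos_iff.2 (hb (v 0))
        have : k ≤ K := hk
        omega
      refine ⟨_, Set.mem_iUnion₂.2 ⟨k + 1 - (b (v 0)).length, hk1,
        (fun j => v (j + 1), circleMap (G (v 0))⁻¹ x),
        circleMap_inv_mem_closure_expandingSet hvx, Prod.ext ?_ rfl⟩⟩
      ext j
      simp only [hφ]
      rw [← concatWord_add_length]
      congr 1
      have := hK (v 0)
      omega
  · intro y
    obtain ⟨v, hv⟩ := exists_forall_mem_closure_expandingSet hcov y
    refine ⟨_, Set.mem_iUnion₂.2 ⟨0, Nat.zero_le K, (v, y), hv, Prod.ext rfl ?_⟩⟩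
    simp only [hφ]
    rw [wordMap_wordPrefix_zero, inv_one, circleMap_one]

end Systems

end MobiusNumeration

theorem mainTheorem8 {A : Type*} [Finite A] [TopologicalSpace A] [DiscreteTopology A]
    (F : A → MobiusNumeration.DiscMobius) :
    ((∃ B : Set (List A), B.Finite ∧ [] ∉ B ∧
        Set.univ ⊆ ⋃ b ∈ B, closure
          (MobiusNumeration.expansionInterval (MobiusNumeration.wordMap F b))) →
      ∃ S : SymbolicDynamics.FullShift.Subshift A ℕ,
        MobiusNumeration.IsMobiusNumberSystem F S) ∧
    (Set.univ ⊆ ⋃ u ∈ {u : List A | u ≠ []},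
        MobiusNumeration.expansionInterval (MobiusNumeration.wordMap F u) →
      ∃ B : Set (List A), B.Finite ∧ [] ∉ B ∧
        Set.univ ⊆ ⋃ b ∈ B, closure
          (MobiusNumeration.expansionInterval (MobiusNumeration.wordMap F b))) := by
  constructor
  · rintro ⟨B, hfin, hnil, hcov⟩
    have : Finite B := hfin
    refine MobiusNumeration.exists_isMobiusNumberSystem_of_cover F (b := fun i : B => i.1)
      (fun i h => hnil (h ▸ i.2)) (hcov.trans ?_)
    rw [Set.biUnion_eq_iUnion]
  · intro hcov
    obtain ⟨B, hB, hfin, hB'⟩ := isCompact_univ.elim_finite_subcover_image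
      (fun u _ => MobiusNumeration.isOpen_expansionInterval (MobiusNumeration.wordMap F u)) hcov
    exact ⟨B, hfin, fun h => hB h rfl,
      hB'.trans (Set.iUnion₂_mono fun b _ => subset_closure)⟩
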